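/- Let $\mu_d$ denote Lebesgue measure on $\mathbb{R}^d$. Let $D \subset \mathbb{R}^d$ be a compact set with $D = \overline{D^\circ}$ and $\mu_d(\partial D) = 0$. Let $\mathcal{F} = \{f_1,\ldots,f_k\}$ be a finite family of injective contractions $f_i : \mathbb{R}^d \to \mathbb{R}^d$ (each Lipschitz with some constant less than $1$), put $\Phi(X) = \bigcup_{i=1}^k f_i(X)$ for $X \subset \mathbb{R}^d$, and assume that the attractor $E$ of $\mathcal{F}$, i.e. the unique non-empty compact set with $E = \Phi(E)$, satisfies $\mu_d(E) = 0$. Suppose that $\mathcal{F}$ is non-overlapping with respect to $D$, i.e. $\mu_d(f_i(D) \cap f_j(D)) = 0$ for all $i \ne j$ (it is not assumed that $f_i(D) \subset D$), and that (i) $\Phi(D \setminus \Phi(D)) \subset D$, (ii) $\Phi(D \cap \Phi^2(D)) \subset D$. Then the set $Y := \overline{D \setminus \Phi(D)}$ has the following properties: (1) $\overline{Y^\circ} = Y$ and $\mu_d(\partial Y) = 0$; (2) $Y, f_1(Y), \ldots, f_k(Y)$ are subsets of $D$ any two of which intersect in a set of $\mu_d$-measure zero; (3) $Y, f_1(D \setminus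 \Phi(Y)), \ldots, f_k(D \setminus \Phi(Y))$ are subsets of $D$ any two of which intersect in a set of $\mu_d$-measure zero. Moreover, $D$ admits a dissection with respect to $\mathcal{F}$: there exists a compact set $X \subset \mathbb{R}^d$ with $\overline{X^\circ} = X$ such that $D = X \cup f_1(X) \cup \cdots \cup f_k(X)$, where $\mu_d(f_i(X) \cap f_j(X)) = 0$ for all $i \neq j$ and $\mu_d(X \cap f_i(X)) = 0$ for every $i$. -/

import Mathlib

open MeasureTheory Set

namespace Dissection

/-- The set map `Φ(X) = f₁(X) ∪ ⋯ ∪ f_k(X)` of a finite family of self-maps of `ℝ^d`. -/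
def Phi {d k : ℕ} (f : Fin k → EuclideanSpace ℝ (Fin d) → EuclideanSpace ℝ (Fin d))
    (X : Set (EuclideanSpace ℝ (Fin d))) : Set (EuclideanSpace ℝ (Fin d)) :=
  ⋃ i, f i '' X

/-- `X` is the closure of its interior. -/
def IsRegularClosed {d : ℕ} (X : Set (EuclideanSpace ℝ (Fin d))) : Prop :=
  closure (interior X) = X

/-- An iterated function system in the sense used for dissections: a finite family of injective
contractions of `ℝ^d` (Lipschitz with a constant less than one). -/
def IsIFS {d k : ℕ} (f : Fin k → EuclideanSpace ℝ (Fin d) → EuclideanSpace ℝ (Fin d)) : Prop :=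
  ∀ i, Function.Injective (f i) ∧ ∃ K : NNReal, ContractingWith K (f i)

/-- `E` is the attractor of `f`: the (unique) non-empty compact set with `E = Φ(E)`. -/
def IsAttractor {d k : ℕ} (f : Fin k → EuclideanSpace ℝ (Fin d) → EuclideanSpace ℝ (Fin d))
    (E : Set (EuclideanSpace ℝ (Fin d))) : Prop :=
  E.Nonempty ∧ IsCompact E ∧ E = Phi f E

/-- The family is non-overlapping with respect to `D`. -/
def IsNonOverlapping {d k : ℕ}
    (f : Fin k → EuclideanSpace ℝ (Fin d) → EuclideanSpace ℝ (Fin d))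
    (D : Set (EuclideanSpace ℝ (Fin d))) : Prop :=
  ∀ i j, i ≠ j → volume (f i '' D ∩ f j '' D) = 0

/-- `X` is the generator of a dissection of `D` with respect to `f`. -/
def IsGenerator {d k : ℕ} (f : Fin k → EuclideanSpace ℝ (Fin d) → EuclideanSpace ℝ (Fin d))
    (D X : Set (EuclideanSpace ℝ (Fin d))) : Prop :=
  IsCompact X ∧ IsRegularClosed X ∧ D = X ∪ ⋃ i, f i '' X ∧
    (∀ i j, i ≠ j → volume (f i '' X ∩ f j '' X) = 0) ∧
    ∀ i, volume (X ∩ f i '' X) = 0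

/-- `D` admits a dissection with respect to `f`. -/
def AdmitsDissection {d k : ℕ}
    (f : Fin k → EuclideanSpace ℝ (Fin d) → EuclideanSpace ℝ (Fin d))
    (D : Set (EuclideanSpace ℝ (Fin d))) : Prop :=
  ∃ X, IsGenerator f D X

/-- `Y, f₁(B), …, f_k(B)` are subsets of `D` which are mutually disjoint in measure. -/
def DisjointInMeasureWithin {d k : ℕ}
    (f : Fin k → EuclideanSpace ℝ (Fin d) → EuclideanSpace ℝ (Fin d))
    (D Y B : Set (EuclideanSpace ℝ (Fin d))) : Prop :=
  Y ⊆ D ∧ (∀ i, f i '' B ⊆ D) ∧ (∀ i, volume (Y ∩ f i '' B) = 0) ∧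
    ∀ i j, i ≠ j → volume (f i '' B ∩ f j '' B) = 0

/-- `Y` is an initial piece for a dissection of `D`: it is regular closed with null boundary,
and both `Y, f₁(Y), …, f_k(Y)` and `Y, f₁(D \ Φ(Y)), …, f_k(D \ Φ(Y))` are subsets of `D` which
are mutually disjoint in measure. -/
def IsInitialPiece {d k : ℕ}
    (f : Fin k → EuclideanSpace ℝ (Fin d) → EuclideanSpace ℝ (Fin d))
    (D Y : Set (EuclideanSpace ℝ (Fin d))) : Prop :=
  IsRegularClosed Y ∧ volume (frontier Y) = 0 ∧
    DisjointInMeasureWithin f D Y Y ∧ DisjointInMeasureWithin f D Y (D \ Phi f Y)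

end Dissection

/-! For the initial piece, everything reduces to `Φ(D)` being closed with null boundary. The
generator is the closure of an open set `U` with `U = D° \ Φ(D \ Φ(U))`, taken as the least fixed
point of this monotone operator. Minimality forces `U` and `Φ(U)` to be disjoint
(`exists_isOpen_eq_interior_diff`), and (i) and (ii) put `Φ(U)` inside `D`. The remainder `Z = D \
(U ∪ Φ(U))` satisfies `Z ⊆ ∂D ∪ Φ(Z)`; pulling points back repeatedly places `Z` in the attractor
together with the iterates `Φⁿ(∂D)`, all null. Hence the closures of `U` and `Φ(U)` fill `D`.

Both halves need each `f i` to be open, i.e. invariance of domain. That is derived from the absence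
of a Lipschitz retraction onto the sphere, itself proved by integrating a Jacobian that is
polynomial in a homotopy parameter. -/

open Polynomial in
/-- Polynomials of degree at most `n` are extrapolated to `1` from arbitrarily small nodes. -/
theorem exists_extrapolation_weights (n : ℕ) {δ : ℝ} (hδ : 0 < δ) :
    ∃ t c : Fin (n + 1) → ℝ, (∀ j, 0 ≤ t j ∧ t j < δ) ∧
      ∀ p : ℝ[X], p.natDegree ≤ n → p.eval 1 = ∑ j, c j * p.eval (t j) := by
  have hn : (0 : ℝ) < n + 1 := by positivity
  let t : Fin (n + 1) → ℝ := fun j => δ * ((j : ℕ) / (n + 1))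
  refine ⟨t, fun j => (Lagrange.basis Finset.univ t j).eval 1, fun j => ⟨by positivity, ?_⟩, ?_⟩
  · have : ((j : ℕ) : ℝ) / (n + 1) < 1 := by
      rw [div_lt_one hn]; exact_mod_cast j.2
    exact mul_lt_of_lt_one_right hδ this
  · intro p hp
    have hinj : Set.InjOn t (Finset.univ : Finset (Fin (n + 1))) := by
      intro i _ j _ hij
      have h := mul_left_cancel₀ hδ.ne' hij
      rw [div_left_inj' hn.ne'] at h
      exact Fin.ext (by exact_mod_cast h)
    have hdeg : p.degree < (Finset.univ : Finset (Fin (n + 1))).card := by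
      rw [Finset.card_univ, Fintype.card_fin]
      exact lt_of_le_of_lt (degree_le_of_natDegree_le hp) (by exact_mod_cast Nat.lt_succ_self n)
    conv_lhs => rw [Lagrange.eq_interpolate hinj hdeg]
    simp [Lagrange.interpolate_apply, eval_finsetSum, mul_comm]

/-! ### Maps near the identity. -/

section
variable {E : Type*} [NormedAddCommGroup E] [NormedSpace ℝ E] [FiniteDimensional ℝ E]

open Polynomial in
theorem exists_polynomial_det_id_add_smul (A : E →L[ℝ] E) :
    ∃ p : ℝ[X], p.natDegree ≤ Module.finrank ℝ E ∧
      ∀ t : ℝ, p.eval t = (ContinuousLinearMap.id ℝ E + t • A).det := by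
  let b := Module.finBasis ℝ E
  let M := LinearMap.toMatrix b b (A : E →ₗ[ℝ] E)
  refine ⟨((X : ℝ[X]) • M.map C + (1 : Matrix _ _ ℝ).map C).det, ?_, fun t => ?_⟩
  · simpa using natDegree_det_X_add_C_le M 1
  · rw [ContinuousLinearMap.det, ← LinearMap.det_toMatrix b, ← coe_evalRingHom, RingHom.map_det]
    congr 1
    ext i j
    simp [M, LinearMap.toMatrix_apply, Matrix.one_apply, Module.Basis.repr_self,
      Finsupp.single_apply, add_comm, eq_comm]
    split_ifs <;> simp [mul_comm]

/-- The operator stays injective along the segment from parameter `0`, where the determinant is `1`,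
so the sign cannot change. -/
theorem det_id_add_smul_pos {A : E →L[ℝ] E} {K : ℝ} (hA : ‖A‖ ≤ K) {t : ℝ} (ht : 0 ≤ t)
    (htK : t * K < 1) : 0 < (ContinuousLinearMap.id ℝ E + t • A).det := by
  have hK : 0 ≤ K := (norm_nonneg A).trans hA
  have hne : ∀ s ∈ Icc 0 t, (ContinuousLinearMap.id ℝ E + s • A).det ≠ 0 := by
    intro s hs h0
    obtain ⟨v, hv, hv0⟩ := Submodule.exists_mem_ne_zero_of_ne_bot
      (LinearMap.det_eq_zero_iff_ker_ne_bot.1 h0)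
    have hv' : v + s • A v = 0 := by simpa using hv
    have h1 : ‖v‖ ≤ s * (K * ‖v‖) := by
      calc ‖v‖ = ‖s • A v‖ := by
            simpa only [norm_neg] using congrArg norm (eq_neg_of_add_eq_zero_left hv')
        _ = s * ‖A v‖ := by rw [norm_smul, Real.norm_of_nonneg hs.1]
        _ ≤ s * (K * ‖v‖) := mul_le_mul_of_nonneg_left (A.le_of_opNorm_le hA v) hs.1
    have h2 : s * K ≤ t * K := mul_le_mul_of_nonneg_right hs.2 hK
    have h3 : 0 < ‖v‖ := norm_pos_iff.2 hv0
    nlinarith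
  have hcont : Continuous fun s : ℝ => (ContinuousLinearMap.id ℝ E + s • A).det :=
    ContinuousLinearMap.continuous_det.comp (by fun_prop)
  by_contra! hneg
  have h0 : (ContinuousLinearMap.id ℝ E + (0 : ℝ) • A).det = 1 := by
    rw [zero_smul, add_zero]; exact LinearMap.det_id
  obtain ⟨s, hs, hs0⟩ := intermediate_value_Icc' ht hcont.continuousOn
    ⟨hneg, by rw [h0]; exact zero_le_one⟩
  exact hne s hs hs0

/-- A small multiple of a Lipschitz map, added to the identity, permutes the space. -/
theorem bijective_id_add_smul {h : E → E} {K : NNReal} (hh : LipschitzWith K h) {t : ℝ}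
    (ht : 0 ≤ t) (htK : t * K < 1) : Function.Bijective fun x => x + t • h x := by
  constructor
  · intro x y hxy
    have h1 : x - y = t • (h y - h x) := by
      rw [smul_sub]
      have : x + t • h x = y + t • h y := hxy
      rw [sub_eq_sub_iff_add_eq_add, this, add_comm]
    have h2 : ‖x - y‖ ≤ t * (K * ‖x - y‖) := by
      calc ‖x - y‖ = t * ‖h y - h x‖ := by rw [h1, norm_smul, Real.norm_of_nonneg ht]
        _ ≤ t * (K * ‖x - y‖) := by
          rw [norm_sub_rev x y]
          exact mul_le_mul_of_nonneg_left (hh.norm_sub_le y x) ht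
    by_contra hne
    have h3 : 0 < ‖x - y‖ := norm_pos_iff.2 (sub_ne_zero.2 hne)
    nlinarith
  · intro y
    have hc : ContractingWith (t.toNNReal * K) fun x => y - t • h x := by
      refine ⟨?_, LipschitzWith.of_dist_le_mul fun a b => ?_⟩
      · rw [← NNReal.coe_lt_coe]; simpa [Real.coe_toNNReal t ht] using htK
      · rw [dist_sub_left, dist_smul₀, Real.norm_of_nonneg ht, NNReal.coe_mul,
          Real.coe_toNNReal t ht, mul_assoc]
        exact mul_le_mul_of_nonneg_left (hh.dist_le_mul a b) ht
    exact ⟨hc.fixedPoint, by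
      have := hc.fixedPoint_isFixedPt
      exact (eq_sub_iff_add_eq.1 this.symm)⟩

end

/-! ### The no-retraction theorem. -/

section
variable {E : Type*} [NormedAddCommGroup E] [InnerProductSpace ℝ E] [FiniteDimensional ℝ E]

open Metric in
/-- There is no Lipschitz retraction of the unit ball onto its sphere. -/
theorem not_forall_norm_add_eq_one {h : E → E} {K : NNReal} (hh : LipschitzWith K h)
    (hd : ∀ x ∈ ball (0 : E) 1, DifferentiableAt ℝ h x) (h0 : ∀ x, 1 ≤ ‖x‖ → h x = 0) :
    ¬ ∀ x ∈ ball (0 : E) 1, ‖x + h x‖ = 1 := by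
  intro hr
  borelize E
  let μ : Measure E := Measure.addHaar
  -- For small `t` the map `x + t • h x` permutes the ball, so `J t` integrates to its volume. As
  -- `J` is polynomial in `t` with degree bounded uniformly in `x`, this extrapolates to `t = 1`,
  -- where `J` vanishes.
  let J : ℝ → E → ℝ := fun t x => (ContinuousLinearMap.id ℝ E + t • fderiv ℝ h x).det
  have hK : (0 : ℝ) < 1 / (K + 1) := by positivity
  have hK' : ∀ t : ℝ, 0 ≤ t → t < 1 / (K + 1) → t * K < 1 := by
    intro t ht htK
    rw [lt_div_iff₀ (by positivity)] at htK
    linarith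
  obtain ⟨t, c, htc, hp⟩ := exists_extrapolation_weights (Module.finrank ℝ E) hK
  have hJ1 : ∀ x, J 1 x = ∑ j, c j * J (t j) x := by
    intro x
    obtain ⟨p, hpd, hpe⟩ := exists_polynomial_det_id_add_smul (fderiv ℝ h x)
    have := hp p hpd
    simpa only [hpe] using this
  have hc1 : ∑ j, c j = 1 := by simpa using (hp 1 (by simp)).symm
  have hJmeas : ∀ s, Measurable (J s) := fun s =>
    ContinuousLinearMap.continuous_det.measurable.comp
      (((measurable_fderiv ℝ h).const_smul s).const_add _)
  have hpos : ∀ j x, 0 < J (t j) x := fun j x =>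
    det_id_add_smul_pos (norm_fderiv_le_of_lipschitz ℝ hh) (htc j).1 (hK' _ (htc j).1 (htc j).2)
  have hderiv : ∀ s : ℝ, ∀ x ∈ ball (0 : E) 1, HasFDerivAt (fun x => x + s • h x)
      (ContinuousLinearMap.id ℝ E + s • fderiv ℝ h x) x := fun s x hx =>
    (hasFDerivAt_id x).add ((hd x hx).hasFDerivAt.const_smul s)
  have himage : ∀ j, (fun x => x + t j • h x) '' ball (0 : E) 1 = ball 0 1 := by
    intro j
    have hb := bijective_id_add_smul hh (htc j).1 (hK' _ (htc j).1 (htc j).2)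
    have hcompl : (fun x => x + t j • h x) '' (ball (0 : E) 1)ᶜ = (ball 0 1)ᶜ := by
      rw [Set.image_congr (g := id), image_id]
      intro x hx
      have : 1 ≤ ‖x‖ := by simpa using hx
      simp [h0 x this]
    rw [Set.image_compl_eq hb] at hcompl
    exact compl_injective hcompl
  have hlint : ∀ j, ∫⁻ x in ball (0 : E) 1, ENNReal.ofReal (J (t j) x) ∂μ = μ (ball 0 1) := by
    intro j
    have hb := bijective_id_add_smul hh (htc j).1 (hK' _ (htc j).1 (htc j).2)
    have := lintegral_abs_det_fderiv_eq_addHaar_image μ (measurableSet_ball (x := (0 : E)) (ε := 1))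
      (fun x hx => (hderiv (t j) x hx).hasFDerivWithinAt) hb.1.injOn
    rw [himage] at this
    rw [← this]
    exact lintegral_congr fun x => by rw [abs_of_pos (hpos j x)]
  have hint : ∀ j, Integrable (J (t j)) (μ.restrict (ball 0 1)) := by
    intro j
    refine ⟨(hJmeas _).aestronglyMeasurable, ?_⟩
    rw [hasFiniteIntegral_iff_ofReal (.of_forall fun x => (hpos j x).le), hlint j]
    exact measure_ball_lt_top
  have hval : ∀ j, ∫ x in ball (0 : E) 1, J (t j) x ∂μ = μ.real (ball 0 1) := by
    intro j
    rw [integral_eq_lintegral_of_nonneg_ae (.of_forall fun x => (hpos j x).le)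
      (hJmeas _).aestronglyMeasurable, hlint j]
    rfl
  have htotal : ∫ x in ball (0 : E) 1, J 1 x ∂μ = μ.real (ball 0 1) := by
    simp_rw [hJ1]
    rw [integral_finsetSum _ fun j _ => (hint j).const_mul _]
    simp_rw [integral_const_mul, hval, ← Finset.sum_mul, hc1, one_mul]
  -- Differentiating `‖x + h x‖² = 1` makes the range of the derivative orthogonal to the unit
  -- vector `x + h x`, so the derivative is not surjective.
  have hzero : ∀ x ∈ ball (0 : E) 1, J 1 x = 0 := by
    intro x hx
    by_contra hne
    let L := LinearMap.equivOfDetNeZero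
      ((ContinuousLinearMap.id ℝ E + (1 : ℝ) • fderiv ℝ h x : E →L[ℝ] E) : E →ₗ[ℝ] E) hne
    have hD := hderiv 1 x hx
    simp only [one_smul] at hD
    have hconst : (fun y => ‖y + h y‖ ^ 2) =ᶠ[nhds x] fun _ => 1 := by
      filter_upwards [isOpen_ball.mem_nhds hx] with y hy
      rw [hr y hy, one_pow]
    have hD2 := hD.norm_sq.unique ((hasFDerivAt_const (1 : ℝ) x).congr_of_eventuallyEq hconst)
    obtain ⟨v, hv⟩ := L.surjective (x + h x)
    have hv' : (ContinuousLinearMap.id ℝ E + fderiv ℝ h x) v = x + h x := by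
      rw [← hv]
      simp [L, LinearMap.equivOfDetNeZero]
    have := DFunLike.congr_fun hD2 v
    simp only [smul_apply, ContinuousLinearMap.comp_apply, hv',
      innerSL_apply_apply, real_inner_self_eq_norm_sq, hr x hx] at this
    norm_num at this
  rw [setIntegral_eq_zero_of_forall_eq_zero hzero] at htotal
  have hvol : 0 < μ.real (ball (0 : E) 1) :=
    ENNReal.toReal_pos (measure_ball_pos μ 0 one_pos).ne' measure_ball_lt_top.ne
  exact hvol.ne htotal

end

/-! ### Existence of zeros, and invariance of domain. -/

section
variable {E : Type*} [NormedAddCommGroup E] [InnerProductSpace ℝ E] [FiniteDimensional ℝ E]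

open Metric in
/-- A smooth map which is the identity off the unit ball has a zero. -/
theorem ContDiff.exists_eq_zero_of_eq_id {F : E → E} (hF : ContDiff ℝ 1 F)
    (hid : ∀ x, 1 ≤ ‖x‖ → F x = x) : ∃ x, F x = 0 := by
  by_contra! hne
  let v : E → E := fun x => ‖F x‖⁻¹ • F x
  have hv : ContDiff ℝ 1 v :=
    ((hF.norm ℝ hne).inv fun x => norm_ne_zero_iff.2 (hne x)).smul hF
  have hv1 : ∀ x, ‖v x‖ = 1 := fun x => by
    simp [v, norm_smul, inv_mul_cancel₀ (norm_ne_zero_iff.2 (hne x))]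
  -- The map `x + h x` has norm one on the ball and is the identity outside. Since `h` vanishes off
  -- the ball, its Lipschitz bound on radius `2` becomes global.
  let h : E → E := fun x => max ‖x‖ 1 • v x - x
  have h0 : ∀ x, 1 ≤ ‖x‖ → h x = 0 := by
    intro x hx
    have : ‖x‖ ≠ 0 := by positivity
    simp [h, v, hid x hx, max_eq_left hx, smul_smul, mul_inv_cancel₀ this]
  obtain ⟨K, hK⟩ := (hv.locallyLipschitz.locallyLipschitzOn
    (s := closedBall 0 2)).exists_lipschitzOnWith_of_compact (isCompact_closedBall (0 : E) 2)
  have hball : ∀ x ∈ closedBall (0 : E) 2, ∀ y ∈ closedBall (0 : E) 2,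
      ‖h x - h y‖ ≤ (2 + 2 * K) * ‖x - y‖ := by
    intro x hx y hy
    have hx2 : max ‖x‖ 1 ≤ 2 := max_le (by simpa using hx) one_le_two
    have e : h x - h y = max ‖x‖ 1 • (v x - v y) + (max ‖x‖ 1 - max ‖y‖ 1) • v y - (x - y) := by
      simp only [h, smul_sub, sub_smul]; abel
    have h1 : ‖max ‖x‖ 1 • (v x - v y)‖ ≤ 2 * (K * ‖x - y‖) := by
      rw [norm_smul, Real.norm_of_nonneg (by positivity)]
      exact mul_le_mul hx2 (by simpa [dist_eq_norm] using hK.dist_le_mul x hx y hy)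
        (norm_nonneg _) zero_le_two
    have h2 : ‖(max ‖x‖ 1 - max ‖y‖ 1) • v y‖ ≤ ‖x - y‖ := by
      rw [norm_smul, hv1, mul_one, Real.norm_eq_abs]
      exact (abs_max_sub_max_le_abs _ _ _).trans (abs_norm_sub_norm_le x y)
    rw [e]
    calc _ ≤ _ := norm_sub_le _ _
      _ ≤ _ := add_le_add_left (norm_add_le _ _) _
      _ ≤ (2 + 2 * K) * ‖x - y‖ := by linarith
  have hout : ∀ x y, 2 < ‖y‖ → ‖h x - h y‖ ≤ (2 + 2 * K + 2) * ‖x - y‖ := by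
    intro x y hy
    rw [h0 y (by linarith), sub_zero]
    by_cases hx : 1 ≤ ‖x‖
    · rw [h0 x hx, norm_zero]; positivity
    · push Not at hx
      have h1 : ‖h x‖ ≤ 2 := by
        calc ‖h x‖ ≤ ‖max ‖x‖ 1 • v x‖ + ‖x‖ := norm_sub_le _ _
          _ = 1 + ‖x‖ := by rw [norm_smul, hv1, max_eq_right hx.le]; simp
          _ ≤ 2 := by linarith
      have h2 : 1 ≤ ‖x - y‖ := by
        have := norm_sub_norm_le y x
        rw [norm_sub_rev] at this
        linarith
      have := K.2
      calc ‖h x‖ ≤ 2 * 1 := by linarith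
        _ ≤ (2 + 2 * K + 2) * ‖x - y‖ := by gcongr; have := K.coe_nonneg; linarith
  have hlip : LipschitzWith (2 + 2 * K + 2) h := by
    refine LipschitzWith.of_dist_le_mul fun x y => ?_
    rw [dist_eq_norm, dist_eq_norm]
    push_cast
    by_cases hx : ‖x‖ ≤ 2
    · by_cases hy : ‖y‖ ≤ 2
      · refine (hball x (by simpa using hx) y (by simpa using hy)).trans ?_
        have := norm_nonneg (x - y)
        nlinarith
      · exact hout x y (not_le.1 hy)
    · rw [norm_sub_rev, norm_sub_rev x]; exact hout y x (not_le.1 hx)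
  have heq : ∀ x ∈ ball (0 : E) 1, h x = v x - x := fun x hx => by
    have : ‖x‖ < 1 := by simpa using hx
    simp [h, max_eq_right this.le]
  refine not_forall_norm_add_eq_one hlip (fun x hx => ?_) h0 fun x hx => ?_
  · refine DifferentiableAt.congr_of_eventuallyEq
      ((hv.differentiable one_ne_zero x).sub differentiableAt_id) ?_
    filter_upwards [isOpen_ball.mem_nhds hx] with y hy using heq y hy
  · rw [heq x hx, add_sub_cancel, hv1]

/-- A continuous map which is the identity off a ball has a zero. -/
theorem Continuous.exists_eq_zero_of_eq_id {F : E → E} (hF : Continuous F) {R : ℝ} (hR : 0 < R)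
    (hid : ∀ x, R ≤ ‖x‖ → F x = x) : ∃ x, F x = 0 := by
  by_contra! hne
  have hR2 : (2 * R) ≠ 0 := by positivity
  -- Rescaling by `2 * R` rather than `R` leaves a margin: `G` is already smooth near `1 ≤ ‖x‖`, so
  -- the approximation can agree with it there. The tolerance `‖G x‖` keeps the approximation free
  -- of zeros.
  let G : E → E := fun x => (2 * R)⁻¹ • F ((2 * R) • x)
  have hG : Continuous G := by fun_prop
  have hGne : ∀ x, G x ≠ 0 := fun x => smul_ne_zero (inv_ne_zero hR2) (hne _)
  have hGid : ∀ x, 1 / 2 ≤ ‖x‖ → G x = x := by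
    intro x hx
    have : R ≤ ‖(2 * R) • x‖ := by
      rw [norm_smul, Real.norm_of_nonneg (by positivity)]; nlinarith
    simp only [G]
    rw [hid _ this, inv_smul_smul₀ hR2]
  obtain ⟨g, hg, hgG, hgS, -⟩ := hG.exists_contDiff_approx_and_eqOn 1 hG.norm
    (fun x => norm_pos_iff.2 (hGne x)) (S := {x | 1 ≤ ‖x‖}) (U := {x | 1 / 2 < ‖x‖})
    (isClosed_le continuous_const continuous_norm)
    ((isOpen_lt continuous_const continuous_norm).mem_nhdsSet.2 fun x hx => by
      simp only [mem_ofPred_eq] at hx ⊢; linarith)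
    (contDiff_id.contDiffOn.congr fun x hx => hGid x (le_of_lt hx))
  obtain ⟨x, hx⟩ := ContDiff.exists_eq_zero_of_eq_id (F := g) (by exact_mod_cast hg) fun x hx => by
    rw [hgS hx, hGid x (by linarith)]
  have := hgG x
  rw [hx, dist_zero_left] at this
  exact lt_irrefl _ this

open Metric in
/-- A map of the unit ball at distance at most one from the identity has a zero. -/
theorem ContinuousOn.exists_eq_zero_of_norm_sub_le_one {u : E → E}
    (hu : ContinuousOn u (closedBall 0 1)) (hx : ∀ x ∈ closedBall 0 1, ‖x - u x‖ ≤ 1) :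
    ∃ x ∈ closedBall 0 1, u x = 0 := by
  let P : E → E := fun x => (max 1 ‖x‖)⁻¹ • x
  have hmax : ∀ x : E, 0 < max 1 ‖x‖ := fun x => by positivity
  have hPc : Continuous P :=
    ((continuous_const.max continuous_norm).inv₀ fun x => (hmax x).ne').smul continuous_id
  have hPm : ∀ x, P x ∈ closedBall (0 : E) 1 := by
    intro x
    rw [mem_closedBall_zero_iff, norm_smul, Real.norm_of_nonneg (by positivity),
      inv_mul_le_iff₀ (hmax x), mul_one]
    exact le_max_right _ _
  have hPid : ∀ x, ‖x‖ ≤ 1 → P x = x := fun x hx => by simp [P, max_eq_left hx]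
  -- At a zero of `x - φ x • (P x - u (P x))` one has `‖x‖ ≤ φ x ≤ 1`, hence `φ x = 1` and `P x =
  -- x`, which leaves `u x = 0`.
  let φ : E → ℝ := fun x => max 0 (min 1 (2 - ‖x‖))
  have huP : Continuous fun x => u (P x) := hu.comp_continuous hPc hPm
  have hF : Continuous fun x => x - φ x • (P x - u (P x)) :=
    continuous_id.sub (Continuous.smul (by fun_prop) (hPc.sub huP))
  obtain ⟨x, hx0⟩ := hF.exists_eq_zero_of_eq_id two_pos fun x hx => by
    have : φ x = 0 := max_eq_left ((min_le_right _ _).trans (by linarith))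
    simp [this]
  have hle : ‖x‖ ≤ φ x := by
    have h1 : ‖x‖ = φ x * ‖P x - u (P x)‖ := by
      conv_lhs => rw [sub_eq_zero.1 hx0]
      rw [norm_smul, Real.norm_of_nonneg (le_max_left _ _)]
    have h2 : 0 ≤ φ x := le_max_left _ _
    nlinarith [hx (P x) (hPm x)]
  have hx1 : ‖x‖ ≤ 1 := hle.trans (max_le zero_le_one (min_le_left _ _))
  have hφ : φ x = 1 := by
    simp only [φ]; rw [min_eq_left (by linarith), max_eq_right zero_le_one]
  refine ⟨x, by simpa using hx1, ?_⟩
  simpa [hφ, hPid x hx1] using hx0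

-- Otherwise some `c` near `f 0` is missed by the image. Pushing the image radially out of the
-- `ε`-ball about `c`, then applying a perturbation `q` of an extended inverse `G`, yields a map
-- close to the identity on the ball but without zeros.
open Metric in
theorem image_closedBall_mem_nhds_of_injOn {f : E → E} (hf : ContinuousOn f (closedBall 0 1))
    (hinj : InjOn f (closedBall 0 1)) : f '' closedBall 0 1 ∈ nhds (f 0) := by
  by_contra hn
  borelize E
  have hcpt : IsCompact (closedBall (0 : E) 1) := isCompact_closedBall 0 1
  have h0B : (0 : E) ∈ closedBall (0 : E) 1 := by simp
  have : CompactSpace (closedBall (0 : E) 1) := isCompact_iff_compactSpace.1 hcpt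
  have hemb : Topology.IsClosedEmbedding ((closedBall (0 : E) 1).domRestrict f) :=
    (continuousOn_iff_continuous_domRestrict.1 hf).isClosedEmbedding hinj.injective
  obtain ⟨G, hG⟩ := ContinuousMap.exists_extension hemb ⟨Subtype.val, continuous_subtype_val⟩
  have hGf : ∀ x ∈ closedBall (0 : E) 1, G (f x) = x := fun x hx =>
    DFunLike.congr_fun hG ⟨x, hx⟩
  obtain ⟨ε, hε, hGε⟩ : ∃ ε > 0, ∀ y, dist y (f 0) < 3 * ε → ‖G y‖ < 1 / 10 := by
    obtain ⟨δ, hδ, h⟩ := Metric.continuousAt_iff.1 (G.continuous.continuousAt (x := f 0))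
      (1 / 10) (by norm_num)
    refine ⟨δ / 3, by positivity, fun y hy => ?_⟩
    have := h (x := y) (by linarith)
    rwa [hGf 0 h0B, dist_zero_right] at this
  obtain ⟨c, hcε, hc⟩ : ∃ c, dist c (f 0) < ε ∧ c ∉ f '' closedBall 0 1 := by
    by_contra! h
    exact hn (Filter.mem_of_superset (ball_mem_nhds (f 0) hε) fun y hy => h y hy)
  -- After the push, points lie in `T` or on the sphere. On `T`, `G` is bounded away from zero, so
  -- an error below `δ` is harmless. On the sphere, the `C¹` image is null, so a small translation
  -- by `a` removes any zero.
  let T : Set E := f '' closedBall 0 1 ∩ {y | ε ≤ ‖y - c‖}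
  have hT : IsCompact T := (hcpt.image_of_continuousOn hf).inter_right
    (isClosed_le continuous_const (by fun_prop))
  obtain ⟨δ, hδ, hδ1, hδT⟩ : ∃ δ > 0, δ ≤ 1 / 10 ∧ ∀ y ∈ T, δ ≤ ‖G y‖ := by
    have hpos : ∀ y ∈ T, 0 < ‖G y‖ := by
      rintro _ ⟨⟨x, hx, rfl⟩, hy⟩
      rw [hGf x hx, norm_pos_iff]
      rintro rfl
      have : ε ≤ ‖f 0 - c‖ := hy
      rw [← dist_eq_norm, dist_comm] at this
      linarith
    obtain ⟨m, hm, hmT⟩ := hT.exists_forall_le' G.continuous.norm.continuousOn hpos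
    exact ⟨min (1 / 10) m, lt_min (by norm_num) hm, min_le_left _ _,
      fun z hz => (min_le_right _ _).trans (hmT z hz)⟩
  obtain ⟨p, hp, hpG, -⟩ := G.continuous.exists_contDiff_approx 1 (ε := fun _ => δ / 2)
    continuous_const fun _ => half_pos hδ
  have hnull : (Measure.addHaar : Measure E) (p '' sphere c ε) = 0 :=
    addHaar_image_eq_zero_of_differentiableOn_of_addHaar_eq_zero _
      (hp.differentiable (by simp)).differentiableOn
      (Measure.addHaar_sphere_of_ne_zero _ _ hε.ne')
  obtain ⟨a, haδ, ha⟩ : ∃ a, ‖a‖ < δ / 2 ∧ a ∉ p '' sphere c ε := by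
    by_contra! h
    have : ball (0 : E) (δ / 2) ⊆ p '' sphere c ε := fun a ha => h a (by simpa using ha)
    exact (measure_ball_pos Measure.addHaar 0 (half_pos hδ)).ne' (measure_mono_null this hnull)
  let q : E → E := fun y => p y - a
  have hqG : ∀ y, ‖q y - G y‖ < δ := by
    intro y
    calc ‖q y - G y‖ = ‖(p y - G y) - a‖ := by simp only [q]; congr 1; abel
      _ ≤ ‖p y - G y‖ + ‖a‖ := norm_sub_le _ _
      _ < δ / 2 + δ / 2 := add_lt_add (by simpa [dist_eq_norm] using hpG y) haδ
      _ = δ := add_halves δ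
  let Φ : E → E := fun y => c + (max ε ‖y - c‖ / ‖y - c‖) • (y - c)
  have hne : ∀ x ∈ closedBall (0 : E) 1, ‖f x - c‖ ≠ 0 := fun x hx h =>
    hc ⟨x, hx, sub_eq_zero.1 (norm_eq_zero.1 h)⟩
  have hΦfar : ∀ x ∈ closedBall (0 : E) 1, ε ≤ ‖f x - c‖ → Φ (f x) = f x := by
    intro x hx h
    simp [Φ, max_eq_right h, div_self (hne x hx)]
  have hΦnear : ∀ x ∈ closedBall (0 : E) 1, ‖f x - c‖ ≤ ε → ‖Φ (f x) - c‖ = ε := by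
    intro x hx h
    simp only [Φ, add_sub_cancel_left]
    rw [norm_smul, max_eq_left h, Real.norm_of_nonneg (by positivity), div_mul_cancel₀ _ (hne x hx)]
  have hu : ContinuousOn (fun x => q (Φ (f x))) (closedBall 0 1) := by
    have hq : Continuous q := hp.continuous.sub continuous_const
    refine hq.comp_continuousOn (continuousOn_const.add (ContinuousOn.smul ?_ ?_))
    · exact ContinuousOn.div (by fun_prop) (by fun_prop) hne
    · fun_prop
  obtain ⟨x, hx, hx0⟩ := hu.exists_eq_zero_of_norm_sub_le_one fun x hx => by
    have h1 : ‖G (f x) - G (Φ (f x))‖ ≤ 1 / 10 + 1 / 10 := by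
      by_cases h : ε ≤ ‖f x - c‖
      · rw [hΦfar x hx h]; norm_num
      · push Not at h
        refine (norm_sub_le _ _).trans (add_le_add (hGε _ ?_).le (hGε _ ?_).le)
        · linarith [dist_triangle (f x) c (f 0), dist_eq_norm (f x) c]
        · linarith [dist_triangle (Φ (f x)) c (f 0), dist_eq_norm (Φ (f x)) c, hΦnear x hx h.le]
    have h2 := hqG (Φ (f x))
    rw [norm_sub_rev] at h2
    calc ‖x - q (Φ (f x))‖ = ‖(G (f x) - G (Φ (f x))) + (G (Φ (f x)) - q (Φ (f x)))‖ := by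
          rw [hGf x hx]; congr 1; abel
      _ ≤ _ := norm_add_le _ _
      _ ≤ 1 := by linarith
  by_cases h : ε ≤ ‖f x - c‖
  · rw [hΦfar x hx h] at hx0
    have h1 := hqG (f x)
    rw [hx0, zero_sub, norm_neg] at h1
    exact absurd (hδT (f x) ⟨mem_image_of_mem f hx, h⟩) (not_le.2 h1)
  · exact ha ⟨Φ (f x), by rw [mem_sphere_iff_norm]; exact hΦnear x hx (le_of_not_ge h),
      sub_eq_zero.1 hx0⟩

open Metric in
/-- **Invariance of domain** for injective continuous self-maps of a Euclidean space. -/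
theorem Continuous.isOpenMap_of_injective {f : E → E} (hf : Continuous f)
    (hinj : Function.Injective f) : IsOpenMap f := by
  refine IsOpenMap.of_nhds_le fun x s hs => ?_
  obtain ⟨r, hr, hrs⟩ := Metric.mem_nhds_iff.1 (Filter.mem_map.1 hs)
  have hr2 : r / 2 ≠ 0 := by positivity
  have hA : Continuous fun y : E => f (x + (r / 2) • y) := by fun_prop
  have hAi : Function.Injective fun y : E => f (x + (r / 2) • y) := fun y z h =>
    smul_right_injective E hr2 (add_left_cancel (hinj h))
  have := image_closedBall_mem_nhds_of_injOn hA.continuousOn hAi.injOn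
  simp only [smul_zero, add_zero] at this
  refine Filter.mem_of_superset this ?_
  rintro _ ⟨y, hy, rfl⟩
  apply hrs
  rw [mem_closedBall_zero_iff] at hy
  rw [mem_ball_iff_norm, add_sub_cancel_left, norm_smul, Real.norm_of_nonneg (by positivity)]
  nlinarith
end

/-- Lipschitz maps scale `d`-dimensional Hausdorff measure by a bounded factor, and this measure has
the same null sets as Lebesgue measure. -/
theorem LipschitzWith.volume_image_eq_zero {d : ℕ}
    {f : EuclideanSpace ℝ (Fin d) → EuclideanSpace ℝ (Fin d)} {K : NNReal} (hf : LipschitzWith K f)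
    {s : Set (EuclideanSpace ℝ (Fin d))} (hs : volume s = 0) : volume (f '' s) = 0 := by
  have : (Measure.hausdorffMeasure (d : ℝ) :
      Measure (EuclideanSpace ℝ (Fin d))).IsAddHaarMeasure := by
    simpa using isAddHaarMeasure_hausdorffMeasure (E := EuclideanSpace ℝ (Fin d))
  refine Measure.absolutelyContinuous_isAddHaarMeasure volume (Measure.hausdorffMeasure d) ?_
  have h0 := Measure.absolutelyContinuous_isAddHaarMeasure
    (Measure.hausdorffMeasure (d : ℝ) : Measure (EuclideanSpace ℝ (Fin d))) volume hs
  have := hf.hausdorffMeasure_image_le (Nat.cast_nonneg d) s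
  rwa [h0, mul_zero, nonpos_iff_eq_zero] at this

/-! ### Initial pieces and dissections. -/

namespace Dissection

section
variable {d k : ℕ} {f : Fin k → EuclideanSpace ℝ (Fin d) → EuclideanSpace ℝ (Fin d)}
  {A B D N U Z : Set (EuclideanSpace ℝ (Fin d))}

theorem mem_Phi {x : EuclideanSpace ℝ (Fin d)} : x ∈ Phi f A ↔ ∃ i, ∃ y ∈ A, f i y = x := by
  simp [Phi]

theorem Phi_mono (h : A ⊆ B) : Phi f A ⊆ Phi f B :=
  iUnion_mono fun _ => image_mono h

theorem image_subset_Phi (i : Fin k) : f i '' A ⊆ Phi f A :=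
  subset_iUnion (fun i => f i '' A) i

theorem isCompact_Phi (hf : ∀ i, Continuous (f i)) (hA : IsCompact A) : IsCompact (Phi f A) :=
  isCompact_iUnion fun i => hA.image (hf i)

theorem isOpen_Phi (hf : ∀ i, IsOpenMap (f i)) (hA : IsOpen A) : IsOpen (Phi f A) :=
  isOpen_iUnion fun i => hf i A hA

theorem Phi_closure_subset (hf : ∀ i, Continuous (f i)) : Phi f (closure A) ⊆ closure (Phi f A) :=
  iUnion_subset fun i => (image_closure_subset_closure_image (hf i)).trans
    (closure_mono (image_subset_Phi i))

theorem IsIFS.continuous (hf : IsIFS f) (i : Fin k) : Continuous (f i) :=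
  (hf i).2.choose_spec.2.continuous

theorem IsIFS.isOpenMap (hf : IsIFS f) (i : Fin k) : IsOpenMap (f i) :=
  (hf.continuous i).isOpenMap_of_injective (hf i).1

theorem IsIFS.volume_image_eq_zero (hf : IsIFS f) (i : Fin k) (hA : volume A = 0) :
    volume (f i '' A) = 0 :=
  (hf i).2.choose_spec.2.volume_image_eq_zero hA

theorem IsIFS.volume_Phi_eq_zero (hf : IsIFS f) (hA : volume A = 0) : volume (Phi f A) = 0 :=
  measure_iUnion_null fun i => hf.volume_image_eq_zero i hA

theorem IsIFS.exists_uniform_constant (hf : IsIFS f) :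
    ∃ K : NNReal, K < 1 ∧ ∀ i, LipschitzWith K (f i) := by
  choose K hK using fun i => (hf i).2
  refine ⟨Finset.univ.sup K, (Finset.sup_lt_iff (by simp)).2 fun i _ => (hK i).1, fun i => ?_⟩
  exact (hK i).2.weaken (Finset.le_sup (Finset.mem_univ i))

/-- Points of a bounded set `Z ⊆ N ∪ Φ(Z)` lie in the attractor or in some `Φⁿ(N)`. -/
theorem subset_attractor_union_iUnion_iterate (hf : IsIFS f)
    {E : Set (EuclideanSpace ℝ (Fin d))} (hE : IsAttractor f E) (hZ : IsCompact Z)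
    (h : Z ⊆ N ∪ Phi f Z) : Z ⊆ E ∪ ⋃ n, (Phi f)^[n] N := by
  obtain ⟨hEn, hEc, hEf⟩ := hE
  obtain ⟨K, hK1, hK⟩ := hf.exists_uniform_constant
  obtain ⟨M, hM⟩ := hZ.bddAbove_image (f := fun x => Metric.infDist x E)
    (Metric.continuous_infDist_pt E).continuousOn
  have hstep : ∀ i x, Metric.infDist (f i x) E ≤ K * Metric.infDist x E := by
    intro i x
    obtain ⟨e, he, hxe⟩ := hEc.exists_infDist_eq_dist hEn x
    rw [hxe]
    refine (Metric.infDist_le_dist_of_mem ?_).trans ((hK i).dist_le_mul x e)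
    rw [hEf]
    exact mem_Phi.2 ⟨i, e, he, rfl⟩
  intro z hz
  by_cases hzN : z ∈ ⋃ n, (Phi f)^[n] N
  · exact Or.inr hzN
  left
  -- A point avoiding all iterates of `N` has a preimage in `Z` that also avoids them; each
  -- pull-back gains a factor `K` in the distance to `E`.
  have key : ∀ n : ℕ, ∀ z ∈ Z, z ∉ ⋃ n, (Phi f)^[n] N →
      Metric.infDist z E ≤ (K : ℝ) ^ n * M := by
    intro n
    induction n with
    | zero => intro z hz _; simpa using hM (mem_image_of_mem _ hz)
    | succ n ih =>
      intro z hz hzN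
      rcases h hz with hN | hΦ
      · exact absurd (mem_iUnion.2 ⟨0, hN⟩) hzN
      · obtain ⟨i, w, hw, rfl⟩ := mem_Phi.1 hΦ
        have hwN : w ∉ ⋃ n, (Phi f)^[n] N := by
          intro hwN
          obtain ⟨m, hm⟩ := mem_iUnion.1 hwN
          refine hzN (mem_iUnion.2 ⟨m + 1, ?_⟩)
          rw [Function.iterate_succ_apply']
          exact mem_Phi.2 ⟨i, w, hm, rfl⟩
        calc Metric.infDist (f i w) E ≤ K * Metric.infDist w E := hstep i w
          _ ≤ K * ((K : ℝ) ^ n * M) := mul_le_mul_of_nonneg_left (ih w hw hwN) K.2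
          _ = (K : ℝ) ^ (n + 1) * M := by ring
  have hlim : Filter.Tendsto (fun n : ℕ => (K : ℝ) ^ n * M) Filter.atTop (nhds 0) := by
    simpa using (tendsto_pow_atTop_nhds_zero_of_lt_one K.2 (by exact_mod_cast hK1)).mul_const M
  have h0 : Metric.infDist z E = 0 :=
    le_antisymm (ge_of_tendsto' hlim fun n => key n z hz hzN) Metric.infDist_nonneg
  exact (hEc.isClosed.mem_iff_infDist_zero hEn).2 h0

theorem volume_eq_zero_of_subset_union_Phi (hf : IsIFS f)
    {E : Set (EuclideanSpace ℝ (Fin d))} (hE : IsAttractor f E) (hE0 : volume E = 0)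
    (hZ : IsCompact Z) (hN : volume N = 0) (h : Z ⊆ N ∪ Phi f Z) : volume Z = 0 := by
  refine measure_mono_null (subset_attractor_union_iUnion_iterate hf hE hZ h)
    (measure_union_null hE0 (measure_iUnion_null fun n => ?_))
  induction n with
  | zero => exact hN
  | succ n ih => rw [Function.iterate_succ_apply']; exact hf.volume_Phi_eq_zero ih

theorem closure_diff_eq_closure_interior_diff {C : Set (EuclideanSpace ℝ (Fin d))}
    (hD : IsRegularClosed D) (hC : IsClosed C) : closure (D \ C) = closure (interior D \ C) := by
  refine Subset.antisymm (closure_minimal ?_ isClosed_closure)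
    (closure_mono (sdiff_subset_sdiff_left interior_subset))
  rintro x ⟨hx, hxC⟩
  rw [sdiff_eq, inter_comm]
  rw [← hD] at hx
  exact hC.isOpen_compl.inter_closure ⟨hxC, hx⟩

theorem isRegularClosed_closure (hU : IsOpen U) : IsRegularClosed (closure U) :=
  Subset.antisymm (closure_minimal interior_subset isClosed_closure)
    (closure_mono (hU.subset_interior_iff.2 subset_closure))

theorem frontier_closure_diff_subset {C : Set (EuclideanSpace ℝ (Fin d))} (hD : IsClosed D)
    (hC : IsClosed C) : frontier (closure (D \ C)) ⊆ frontier D ∪ frontier C := by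
  rw [isClosed_closure.frontier_eq, hD.frontier_eq, hC.frontier_eq]
  rintro x ⟨hx, hxi⟩
  by_cases hxC : x ∈ C
  · refine Or.inr ⟨hxC, fun hi => ?_⟩
    obtain ⟨y, hy, hyD⟩ := mem_closure_iff.1 hx _ isOpen_interior hi
    exact hyD.2 (interior_subset hy)
  · refine Or.inl ⟨closure_minimal sdiff_subset hD hx, fun hi => hxi ?_⟩
    exact interior_maximal ((sdiff_subset_sdiff_left interior_subset).trans subset_closure)
      (isOpen_interior.sdiff hC) ⟨hi, hxC⟩

theorem closure_diff_inter_subset_frontier {C : Set (EuclideanSpace ℝ (Fin d))} :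
    closure (D \ C) ∩ C ⊆ frontier C := by
  rintro x ⟨hx, hxC⟩
  refine ⟨subset_closure hxC, fun hi => ?_⟩
  obtain ⟨y, hy, hyD⟩ := mem_closure_iff.1 hx _ isOpen_interior hi
  exact hyD.2 (interior_subset hy)

/-- By invariance of domain `Φ(D°)` is open, so `∂Φ(D) ⊆ Φ(∂D)`, which is null. -/
theorem IsIFS.volume_frontier_Phi (hf : IsIFS f) (hD : IsCompact D) (hDb : volume (frontier D) = 0) :
    volume (frontier (Phi f D)) = 0 := by
  refine measure_mono_null ?_ (hf.volume_Phi_eq_zero hDb)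
  rw [(isCompact_Phi hf.continuous hD).isClosed.frontier_eq, hD.isClosed.frontier_eq]
  rintro _ ⟨hx, hxi⟩
  obtain ⟨i, y, hy, rfl⟩ := mem_Phi.1 hx
  refine mem_Phi.2 ⟨i, y, ⟨hy, fun hyi => hxi ?_⟩, rfl⟩
  exact interior_maximal (Phi_mono interior_subset) (isOpen_Phi hf.isOpenMap isOpen_interior)
    (mem_Phi.2 ⟨i, y, hyi, rfl⟩)

/-- Under the two hypotheses on `Φ`, the points of `D \ Φ(D \ Φ(D))` have all images in `D`. -/
theorem Phi_diff_subset (h1 : Phi f (D \ Phi f D) ⊆ D)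
    (h2 : Phi f (D ∩ Phi f (Phi f D)) ⊆ D) : Phi f (D \ Phi f (D \ Phi f D)) ⊆ D := by
  intro z hz
  obtain ⟨i, x, ⟨hxD, hx⟩, rfl⟩ := mem_Phi.1 hz
  by_cases hxΦ : x ∈ Phi f D
  · obtain ⟨j, y, hy, rfl⟩ := mem_Phi.1 hxΦ
    have hyΦ : y ∈ Phi f D := by
      by_contra hn
      exact hx (mem_Phi.2 ⟨j, y, ⟨hy, hn⟩, rfl⟩)
    exact h2 (mem_Phi.2 ⟨i, _, ⟨hxD, mem_Phi.2 ⟨j, y, hyΦ, rfl⟩⟩, rfl⟩)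
  · exact h1 (mem_Phi.2 ⟨i, x, ⟨hxD, hxΦ⟩, rfl⟩)

theorem isInitialPiece_closure_diff (hDc : IsCompact D) (hDr : IsRegularClosed D)
    (hDb : volume (frontier D) = 0) (hf : IsIFS f) (hno : IsNonOverlapping f D)
    (h1 : Phi f (D \ Phi f D) ⊆ D) (h2 : Phi f (D ∩ Phi f (Phi f D)) ⊆ D) :
    IsInitialPiece f D (closure (D \ Phi f D)) := by
  have hΦ : IsClosed (Phi f D) := (isCompact_Phi hf.continuous hDc).isClosed
  have hYD : closure (D \ Phi f D) ⊆ D := closure_minimal sdiff_subset hDc.isClosed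
  have hnull : ∀ B ⊆ D, ∀ i, volume (closure (D \ Phi f D) ∩ f i '' B) = 0 := fun B hB i =>
    measure_mono_null ((inter_subset_inter_right _
      ((image_mono hB).trans (image_subset_Phi i))).trans closure_diff_inter_subset_frontier)
      (hf.volume_frontier_Phi hDc hDb)
  have hover : ∀ B ⊆ D, ∀ i j, i ≠ j → volume (f i '' B ∩ f j '' B) = 0 := fun B hB i j hij =>
    measure_mono_null (inter_subset_inter (image_mono hB) (image_mono hB)) (hno i j hij)
  refine ⟨?_, ?_, ⟨hYD, fun i => ?_, hnull _ hYD, hover _ hYD⟩,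
    ⟨hYD, fun i => ?_, hnull _ sdiff_subset, hover _ sdiff_subset⟩⟩
  · rw [closure_diff_eq_closure_interior_diff hDr hΦ]
    exact isRegularClosed_closure (isOpen_interior.sdiff hΦ)
  · exact measure_mono_null (frontier_closure_diff_subset hDc.isClosed hΦ)
      (measure_union_null hDb (hf.volume_frontier_Phi hDc hDb))
  · exact (image_subset_Phi i).trans ((Phi_closure_subset hf.continuous).trans
      (closure_minimal h1 hDc.isClosed))
  · exact (image_subset_Phi i).trans ((Phi_mono (sdiff_subset_sdiff_right
      (Phi_mono subset_closure))).trans (Phi_diff_subset h1 h2))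

/-- There is an open set `U` disjoint from `Φ(U)` such that `U = D° \ Φ(D \ Φ(U))`. -/
theorem exists_isOpen_eq_interior_diff (hDc : IsCompact D) (hf : IsIFS f) :
    ∃ U, IsOpen U ∧ U = interior D \ Phi f (D \ Phi f U) ∧ Disjoint U (Phi f U) := by
  let Q : TopologicalSpace.Opens (EuclideanSpace ℝ (Fin d)) →o
      TopologicalSpace.Opens (EuclideanSpace ℝ (Fin d)) :=
    { toFun := fun U => ⟨interior D \ Phi f (D \ Phi f U), isOpen_interior.sdiff
        (isCompact_Phi hf.continuous (hDc.diff (isOpen_Phi hf.isOpenMap U.2))).isClosed⟩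
      monotone' := fun U V hUV => sdiff_subset_sdiff_right (Phi_mono (sdiff_subset_sdiff_right
        (Phi_mono hUV))) }
  let U := OrderHom.lfp Q
  have hU : (U : Set _) = interior D \ Phi f (D \ Phi f U) :=
    congrArg (fun V : TopologicalSpace.Opens _ => (V : Set (EuclideanSpace ℝ (Fin d))))
      (OrderHom.map_lfp Q).symm
  have hUD : (U : Set _) ⊆ D := by rw [hU]; exact sdiff_subset.trans interior_subset
  refine ⟨U, U.2, hU, ?_⟩
  -- Since `W` misses `Φ(U)`, it suffices that `U ≤ W`. By leastness this follows from `Q W ≤ W`,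
  -- which comes down to `U` missing `Φ(W)`; that holds because `W ⊆ D \ Φ(U)`.
  let W : TopologicalSpace.Opens (EuclideanSpace ℝ (Fin d)) :=
    ⟨interior (D \ Phi f U), isOpen_interior⟩
  have hQW : Q W ≤ W := by
    refine interior_maximal ?_ (Q W).2
    refine sdiff_subset_sdiff interior_subset (Phi_mono fun x hx => ⟨hUD hx, fun hxW => ?_⟩)
    have hx' : x ∈ (U : Set _) := hx
    rw [hU] at hx'
    exact hx'.2 (Phi_mono interior_subset hxW)
  have hUW : U ≤ W := OrderHom.lfp_le Q hQW
  exact disjoint_left.2 fun x hx => (interior_subset (hUW hx)).2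

theorem admitsDissection (hDc : IsCompact D) (hDr : IsRegularClosed D)
    (hDb : volume (frontier D) = 0) (hf : IsIFS f) {E : Set (EuclideanSpace ℝ (Fin d))}
    (hE : IsAttractor f E) (hE0 : volume E = 0) (hno : IsNonOverlapping f D)
    (h1 : Phi f (D \ Phi f D) ⊆ D) (h2 : Phi f (D ∩ Phi f (Phi f D)) ⊆ D) :
    AdmitsDissection f D := by
  obtain ⟨U, hUo, hU, hdisj⟩ := exists_isOpen_eq_interior_diff hDc hf
  have hVo : IsOpen (Phi f U) := isOpen_Phi hf.isOpenMap hUo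
  have hUD : U ⊆ D := by rw [hU]; exact sdiff_subset.trans interior_subset
  have hVD : Phi f U ⊆ D := by
    refine (Phi_mono ?_).trans (Phi_diff_subset h1 h2)
    have : U ⊆ D \ Phi f (D \ Phi f U) :=
      hU.subset.trans (sdiff_subset_sdiff_left interior_subset)
    exact this.trans (sdiff_subset_sdiff_right (Phi_mono (sdiff_subset_sdiff_right (Phi_mono hUD))))
  have hZc : IsCompact (D \ (U ∪ Phi f U)) := hDc.diff (hUo.union hVo)
  have hZ0 : volume (D \ (U ∪ Phi f U)) = 0 := by
    refine volume_eq_zero_of_subset_union_Phi hf hE hE0 hZc hDb ?_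
    rintro x ⟨hxD, hx⟩
    rw [mem_union, not_or] at hx
    by_cases hxi : x ∈ interior D
    · right
      have hxΦ : x ∈ Phi f (D \ Phi f U) := by
        by_contra hn
        exact hx.1 (by rw [hU]; exact ⟨hxi, hn⟩)
      obtain ⟨i, y, hy, rfl⟩ := mem_Phi.1 hxΦ
      exact mem_Phi.2 ⟨i, y, ⟨hy.1, fun h => h.elim
        (fun hyU => hx.2 (mem_Phi.2 ⟨i, y, hyU, rfl⟩)) hy.2⟩, rfl⟩
    · left
      rw [hDc.isClosed.frontier_eq]
      exact ⟨hxD, hxi⟩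
  have hGD : closure U ⊆ D := closure_minimal hUD hDc.isClosed
  have hΦG : Phi f (closure U) ⊆ closure (Phi f U) := Phi_closure_subset hf.continuous
  have hVG : closure (Phi f U) ⊆ D := closure_minimal hVD hDc.isClosed
  refine ⟨closure U, hDc.of_isClosed_subset isClosed_closure hGD, isRegularClosed_closure hUo,
    Subset.antisymm ?_ (union_subset hGD (hΦG.trans hVG)), fun i j hij => ?_, fun i => ?_⟩
  · have hcl : IsClosed (closure U ∪ Phi f (closure U)) := isClosed_closure.union
      (isCompact_Phi hf.continuous (hDc.of_isClosed_subset isClosed_closure hGD)).isClosed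
    -- An open null set is empty; this upgrades covering up to measure zero to an exact covering.
    have hempty : interior D \ (closure U ∪ Phi f (closure U)) = ∅ := by
      rw [← (isOpen_interior.sdiff hcl).measure_eq_zero_iff volume]
      exact measure_mono_null (sdiff_subset_sdiff interior_subset
        (union_subset_union subset_closure (Phi_mono subset_closure))) hZ0
    calc D = closure (interior D) := hDr.symm
      _ ⊆ closure U ∪ Phi f (closure U) := closure_minimal (sdiff_eq_empty.1 hempty) hcl
  · exact measure_mono_null (inter_subset_inter (image_mono hGD) (image_mono hGD)) (hno i j hij)
  · refine measure_mono_null ?_ hZ0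
    rintro x ⟨hxU, hxV⟩
    have hxV' := hΦG (image_subset_Phi i hxV)
    exact ⟨hGD hxU, fun h => h.elim
      (fun h => disjoint_left.1 (hdisj.closure_right hUo) h hxV')
      (fun h => disjoint_left.1 (hdisj.closure_left hVo) hxU h)⟩

end

end Dissection

theorem mainTheorem5 {d k : ℕ}
    (f : Fin k → EuclideanSpace ℝ (Fin d) → EuclideanSpace ℝ (Fin d))
    (D E : Set (EuclideanSpace ℝ (Fin d)))
    (hDc : IsCompact D) (hDr : Dissection.IsRegularClosed D)
    (hDb : volume (frontier D) = 0)
    (hf : Dissection.IsIFS f) (hE : Dissection.IsAttractor f E) (hE0 : volume E = 0)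
    (hno : Dissection.IsNonOverlapping f D)
    (h1 : Dissection.Phi f (D \ Dissection.Phi f D) ⊆ D)
    (h2 : Dissection.Phi f (D ∩ Dissection.Phi f (Dissection.Phi f D)) ⊆ D) :
    Dissection.IsInitialPiece f D (closure (D \ Dissection.Phi f D)) ∧
      Dissection.AdmitsDissection f D :=
  ⟨Dissection.isInitialPiece_closure_diff hDc hDr hDb hf hno h1 h2,
    Dissection.admitsDissection hDc hDr hDb hf hE hE0 hno h1 h2⟩
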